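/- **Lemma 7 (xHaul association).** Let the TBSs form a homogeneous Poisson point process $\Phi_M$ of intensity $\lambda_M>0$ on the ground plane $\mathbb{R}^2\times\{0\}$, and let the UAV-BSs form a Poisson point process $\Phi_B$ of intensity $\lambda_{UB}>0$ on $\mathbb{R}^2\times\mathbb{R}^+$, independent of $\Phi_M$. A tagged UAV-AP, whose location is independent of $(\Phi_M,\Phi_B)$, is at distance $d_a>0$ from the typical user at the origin, and the line joining them makes an angle $\theta\in[-\frac{\pi}{2},\frac{\pi}{2}]$ with the vertical axis, so that the UAV-AP has height $h=d_a\cos\theta$. Let $d_{MB}$ and $d_{UB}$ be its distances from the closest TBS and from the closest UAV-BS. With transmit powers $P_M,P_{UB}>0$, path loss exponent $\alpha_L>0$ and a common path loss coefficient, it associates for xHaul with the UAV-BS tier if $P_{UB}d_{UB}^{-\alpha_L}>P_Md_{MB}^{-\alpha_L}$, and with the TBS tier if $P_Md_{MB}^{-\alpha_L}>P_{UB}d_{UB}^{-\alpha_L}$. Put $$f_{d_{MB}}(x)=2\pi\lambda_M x\,e^{-\pi\lambda_M(x^2-h^2)}\ (x\ge h),\qquad f_{d_{MB}}(x)=0\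 (x<h),$$ $$F''_{d_{UB}}(x)=1-\exp\Big[-\lambda_{UB}\Big(\tfrac43\pi x^3-\tfrac13\pi\big[2x^3-3x^2h+h^3\big]\Big)\Big],\qquad \ell(d_a,\theta)=\Big((d_a\cos\theta)^{-\alpha_L}\tfrac{P_{UB}}{P_M}\Big)^{-1/\alpha_L}$$ (with $\ell(d_a,\theta)=0$ if $\cos\theta=0$). Then, given $d_a$ and $\theta$, the conditional probability that the tagged UAV-AP associates with the UAV-BS tier is $$A_{UB}(d_a,\theta)=\int_{d_a\cos\theta}^{\ell(d_a,\theta)}\Big(1-\exp\Big(-\tfrac43\pi\lambda_{UB}\Big(\tfrac{P_M}{P_{UB}}x^{-\alpha_L}\Big)^{-3/\alpha_L}\Big)\Big)f_{d_{MB}}(x)\,dx+\int_{\ell(d_a,\theta)}^{\infty}F''_{d_{UB}}\Big(\Big(\tfrac{P_M}{P_{UB}}x^{-\alpha_L}\Big)^{-1/\alpha_L}\Big)f_{d_{MB}}(x)\,dx,$$ and the conditional probability that it associates with the TBS tier is $A_{MB}(d_a,\theta)=1-A_{UB}(d_a,\theta)$. Moreover, for $x>h$, $F''_{d_{UB}}(x)$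 is the conditional probability that $d_{UB}\le x$ given the location of the UAV-AP, and its derivative is $$f''_{d_{UB}}(x)=2\pi\lambda_{UB}(x^2+xh)\exp\Big[-\lambda_{UB}\Big(\tfrac23\pi x^3+\pi x^2h-\tfrac13\pi h^3\Big)\Big].$$ -/

import Mathlib

open MeasureTheory ProbabilityTheory Set

noncomputable section

namespace XHaul

/-- A locally finite configuration of points of a metric space. -/
structure Config (E : Type*) [PseudoMetricSpace E] where
  /-- The set of points of the configuration. -/
  carrier : Set E
  /-- Every bounded region contains only finitely many points. -/
  finite_inter : ∀ s : Set E, Bornology.IsBounded s → (carrier ∩ s).Finite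

/-- The number of points of the configuration `φ` in the region `B`. -/
def Config.count {E : Type*} [PseudoMetricSpace E] (B : Set E) (φ : Config E) : ℕ∞ :=
  (φ.carrier ∩ B).encard

/-- The usual sigma-algebra on configurations, generated by the counts `φ ↦ φ(B)`, `B` Borel. -/
instance Config.instMeasurableSpace (E : Type*) [PseudoMetricSpace E] [MeasurableSpace E] :
    MeasurableSpace (Config E) :=
  ⨆ (B : Set E) (_ : MeasurableSet B), MeasurableSpace.comap (Config.count B) inferInstance

/-- `Φ` is, under `P`, a Poisson point process with intensity measure `Λ`: a random locally finite
configuration such that the number of points in a region `B` with `Λ B < ∞` has the Poisson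
distribution with mean `Λ B`, and the numbers of points in disjoint regions are independent. -/
structure IsPoissonPointProcess {Ω E : Type*} [MeasurableSpace Ω] [PseudoMetricSpace E]
    [MeasurableSpace E] (Φ : Ω → Config E) (Λ : Measure E) (P : Measure Ω) : Prop where
  measurable : Measurable Φ
  hasLaw_count : ∀ B : Set E, MeasurableSet B → Λ B ≠ ⊤ →
    HasLaw (fun ω => (Φ ω).count B)
      ((poissonMeasure (Λ B).toNNReal).map (fun n : ℕ => (n : ℕ∞))) P
  iIndepFun_count : ∀ (n : ℕ) (B : Fin n → Set E), (∀ i, MeasurableSet (B i)) →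
    (∀ i j, i ≠ j → Disjoint (B i) (B j)) →
    iIndepFun (fun i ω => (Φ ω).count (B i)) P

/-- The ground plane. -/
abbrev Plane : Type := EuclideanSpace ℝ (Fin 2)

/-- The physical space; the ground is `{x | x 2 = 0}` and `x 2` is the height of the point `x`.
The typical user is at the origin. -/
abbrev Space : Type := EuclideanSpace ℝ (Fin 3)

/-- The ground point of the physical space with given planar coordinates. -/
def onGround (x : Plane) : Space := !₂[x 0, x 1, 0]

/-- Intensity measure of the TBSs: homogeneous on the plane. -/
def intensityTBS (lamM : ℝ) : Measure Plane := ENNReal.ofReal lamM • volume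

/-- Intensity measure of the UAV-BSs: homogeneous on the upper half space. -/
def intensityUAVBS (lamUB : ℝ) : Measure Space :=
  ENNReal.ofReal lamUB • volume.restrict {x : Space | 0 < x 2}

/-- Distance `d_MB` from the position `p` to the closest TBS. -/
def dMB (φM : Config Plane) (p : Space) : ℝ := Metric.infDist p (onGround '' φM.carrier)

/-- Distance `d_UB` from the position `p` to the closest UAV-BS. -/
def dUB (φB : Config Space) (p : Space) : ℝ := Metric.infDist p φB.carrier

/-- Average power received at distance `d` from a transmitter of power `Ptx`, where `lamc` is the
carrier wavelength and `α` the path loss exponent (the fading coefficients have mean one). -/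
def rxPower (lamc α Ptx d : ℝ) : ℝ := (lamc / (4 * Real.pi)) ^ 2 * Ptx * d ^ (-α)

/-- A UAV-AP at the position `p` associates to the UAV-BS tier: the closest UAV-BS is received with
larger power than the closest TBS. -/
def AssociatesUB (lamc α PM PUB : ℝ) (φM : Config Plane) (φB : Config Space) (p : Space) : Prop :=
  rxPower lamc α PM (dMB φM p) < rxPower lamc α PUB (dUB φB p)

/-- A UAV-AP at the position `p` associates to the TBS tier: the closest TBS is received with
larger power than the closest UAV-BS. -/
def AssociatesMB (lamc α PM PUB : ℝ) (φM : Config Plane) (φB : Config Space) (p : Space) : Prop :=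
  rxPower lamc α PUB (dUB φB p) < rxPower lamc α PM (dMB φM p)

/-- The position `p` has distance `d` from the typical user at the origin, and the line from the
user to `p` makes the angle `θ` with the vertical axis (up to sign), so that `p` has height
`d cos θ`. -/
def HasAccessGeometry (p : Space) (d θ : ℝ) : Prop :=
  0 < d ∧ θ ∈ Icc (-(Real.pi / 2)) (Real.pi / 2) ∧ dist p 0 = d ∧ p 2 = d * Real.cos θ

/-- The density `f_{d_MB}(x | d, θ)`, supported on `x ≥ h = d cos θ`. -/
def fMB (lamM d θ x : ℝ) : ℝ :=
  if d * Real.cos θ ≤ x then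
    2 * x * Real.pi * lamM * Real.exp (-Real.pi * lamM * (x ^ 2 - (d * Real.cos θ) ^ 2))
  else 0

/-- The density `f''_{d_UB}(x | d, θ)`, with `h = d cos θ`. -/
def fUBcap (lamUB d θ x : ℝ) : ℝ :=
  2 * Real.pi * lamUB * (x ^ 2 + x * (d * Real.cos θ)) *
    Real.exp (-lamUB * (2 / 3 * Real.pi * x ^ 3 + x ^ 2 * Real.pi * (d * Real.cos θ)
      - 1 / 3 * Real.pi * (d * Real.cos θ) ^ 3))

/-- The cap-corrected distribution function `F''_{d_UB}(x)`, with `h = d cos θ`. -/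
def FUBcap (lamUB d θ x : ℝ) : ℝ :=
  1 - Real.exp (-lamUB * (4 / 3 * Real.pi * x ^ 3 - 1 / 3 * Real.pi *
    (2 * x ^ 3 - 3 * x ^ 2 * (d * Real.cos θ) + (d * Real.cos θ) ^ 3)))

/-- The splitting point `ℓ(d, θ)`. -/
def ell (α PM PUB d θ : ℝ) : ℝ := ((d * Real.cos θ) ^ (-α) * (PUB / PM)) ^ (-(1 / α))

/-- Integrand of `A_UB(d, θ)` below `ℓ(d, θ)`. -/
def lowerIntegrand (lamM lamUB α PM PUB d θ x : ℝ) : ℝ :=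
  (1 - Real.exp (-(4 / 3) * Real.pi * lamUB * (PM / PUB * x ^ (-α)) ^ (-(3 / α)))) *
    fMB lamM d θ x

/-- Integrand of `A_UB(d, θ)` above `ℓ(d, θ)`. -/
def upperIntegrand (lamM lamUB α PM PUB d θ x : ℝ) : ℝ :=
  FUBcap lamUB d θ ((PM / PUB * x ^ (-α)) ^ (-(1 / α))) * fMB lamM d θ x

/-- The integral expression for `A_UB(d, θ)`. -/
def AUB (lamM lamUB α PM PUB d θ : ℝ) : ℝ :=
  (∫ x in (d * Real.cos θ)..(ell α PM PUB d θ), lowerIntegrand lamM lamUB α PM PUB d θ x) +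
    ∫ x in Ioi (ell α PM PUB d θ), upperIntegrand lamM lamUB α PM PUB d θ x

end XHaul

end

/-! Fix a position at height `h` and put `k = (PUB / PM) ^ (1 / α)`. At positive distances the power
comparison is `d_UB < k * d_MB`, so only the laws of the two distances matter. Both come from void
probabilities: a nearest distance is at least `r` exactly when no point lies in the open ball of
radius `r`. For the TBSs that ball cuts the ground in a disc of squared radius `r ^ 2 - h ^ 2`,
which yields the density `fMB` (`map_dMB`). For the UAV-BSs the relevant region is the full ball if
`r ≤ h`, and the ball minus the cap below ground if `r > h` (`voidExponent`).

By independence and Fubini, the probability of `d_UB < k * d_MB` is the integral of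
`assocIntegrand`. The case distinction in the void exponent occurs at `k * x = h`, that is at `x =
ℓ`, and cutting there gives the two integrals (`AUB_eq_integral`). Spheres carry no intensity, so
ties have probability zero and the TBS tier receives the complementary probability.

These values depend on the position only through `d` and `θ`. For a random position independent of
the processes, freezing the position therefore turns them into conditional probabilities
(`condExp_indicator_eq_of_indepFun`). -/

namespace XHaul

/-! ### Nearest-point distances and empty balls -/

theorem Config.count_eq_zero {E : Type*} [PseudoMetricSpace E] {B : Set E} {φ : Config E} :
    φ.count B = 0 ↔ φ.carrier ∩ B = ∅ := by
  simp [Config.count]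

theorem Config.le_infDist_iff {E F : Type*} [PseudoMetricSpace E] [PseudoMetricSpace F]
    {g : E → F} {p : F} {r : ℝ} {φ : Config E}
    (hφ : φ.carrier.Nonempty) :
    r ≤ Metric.infDist p (g '' φ.carrier) ↔ φ.count (g ⁻¹' Metric.ball p r) = 0 := by
  rw [Config.count_eq_zero, ← not_lt, Metric.infDist_lt_iff (hφ.image g),
    Set.eq_empty_iff_forall_notMem]
  simp only [exists_mem_image, mem_inter_iff, mem_preimage, Metric.mem_ball, not_exists, not_and,
    dist_comm p]

/-- The strict version uses the closed ball, so it needs the nearest point to be attained; local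
finiteness provides this. -/
theorem Config.lt_infDist_iff {E : Type*} [PseudoMetricSpace E] {p : E} {r : ℝ} {φ : Config E}
    (hφ : φ.carrier.Nonempty) :
    r < Metric.infDist p φ.carrier ↔ φ.count (Metric.closedBall p r) = 0 := by
  rw [Config.count_eq_zero, Set.eq_empty_iff_forall_notMem]
  constructor
  · rintro h y ⟨hy, hyr⟩
    exact (h.trans_le (Metric.infDist_le_dist_of_mem hy)).not_ge
      (by simpa [dist_comm] using hyr)
  · intro h
    by_contra! hle
    have hfin := φ.finite_inter (Metric.closedBall p (r + 1)) Metric.isBounded_closedBall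
    obtain ⟨y, hy, hyr⟩ := (Metric.infDist_lt_iff hφ).1 (hle.trans_lt (lt_add_one r))
    -- `z` is a nearest point. It lies outside the closed ball of radius `r`, so an infimum of at
    -- most `r` would force a point nearer than `z`.
    obtain ⟨z, hz, hmin⟩ := hfin.exists_minimalFor (fun z => dist p z) _
      ⟨y, hy, by simpa [dist_comm] using hyr.le⟩
    have hzr : r < dist p z := by
      by_contra! hzr
      exact h z ⟨hz.1, by simpa [dist_comm] using hzr⟩
    obtain ⟨w, hw, hwz⟩ := (Metric.infDist_lt_iff hφ).1
      (hle.trans_lt (lt_min hzr (lt_add_one r)))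
    have hwS : w ∈ φ.carrier ∩ Metric.closedBall p (r + 1) :=
      ⟨hw, by simpa [dist_comm] using (lt_min_iff.1 hwz).2.le⟩
    have := hmin hwS (lt_min_iff.1 hwz).1.le
    exact absurd (lt_min_iff.1 hwz).1 (not_lt.2 this)

/-! ### Measurability and void probabilities of Poisson processes -/

section Poisson

variable {Ω E F : Type*} [MeasurableSpace Ω] [PseudoMetricSpace E] [MeasurableSpace E]
  [PseudoMetricSpace F]

theorem Config.measurable_count {B : Set E} (hB : MeasurableSet B) :
    Measurable (Config.count B) := by
  rw [measurable_iff_comap_le]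
  exact le_iSup₂_of_le (f := fun (B : Set E) (_ : MeasurableSet B) =>
    MeasurableSpace.comap (Config.count B) inferInstance) B hB le_rfl

theorem Config.measurableSet_count_eq_zero {B : Set E} (hB : MeasurableSet B) :
    MeasurableSet {φ : Config E | φ.count B = 0} :=
  Config.measurable_count hB (measurableSet_singleton 0)

theorem Config.measurable_infDist [MeasurableSpace F] [OpensMeasurableSpace F] {g : E → F}
    (hg : Measurable g) (p : F) :
    Measurable fun φ : Config E => Metric.infDist p (g '' φ.carrier) := by
  refine measurable_of_Ici fun r => ?_
  rcases le_or_gt r 0 with hr | hr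
  · convert MeasurableSet.univ
    ext φ
    simpa using hr.trans Metric.infDist_nonneg
  -- `Metric.infDist` to the empty set is `0`, so for `r > 0` the empty configuration has to be
  -- removed by hand.
  · have h : (fun φ : Config E => Metric.infDist p (g '' φ.carrier)) ⁻¹' Ici r =
        {φ | φ.count univ = 0}ᶜ ∩ {φ | φ.count (g ⁻¹' Metric.ball p r) = 0} := by
      ext φ
      rcases φ.carrier.eq_empty_or_nonempty with h0 | h0
      · simp [Config.count, h0, hr]
      · simp only [mem_preimage, mem_Ici, Config.le_infDist_iff h0, mem_inter_iff, mem_compl_iff,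
          mem_ofPred_eq, iff_and_self]
        intro _
        simpa [Config.count_eq_zero] using h0.ne_empty
    rw [h]
    exact (Config.measurableSet_count_eq_zero MeasurableSet.univ).compl.inter
      (Config.measurableSet_count_eq_zero (hg Metric.isOpen_ball.measurableSet))

namespace IsPoissonPointProcess

variable {P : Measure Ω} {Φ : Ω → Config E} {Λ : Measure E}

theorem measure_count_eq_zero (hΦ : IsPoissonPointProcess Φ Λ P) {B : Set E}
    (hB : MeasurableSet B) (hΛ : Λ B ≠ ⊤) :
    P {ω | (Φ ω).count B = 0} = ENNReal.ofReal (Real.exp (-(Λ B).toReal)) := by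
  have h := hΦ.hasLaw_count B hB hΛ
  have h1 : P {ω | (Φ ω).count B = 0} = P.map (fun ω => (Φ ω).count B) {0} := by
    have hm : Measurable fun ω => (Φ ω).count B := (Config.measurable_count hB).comp hΦ.measurable
    rw [Measure.map_apply hm (measurableSet_singleton 0)]
    rfl
  have h2 : (fun n : ℕ => (n : ℕ∞)) ⁻¹' {0} = {0} := by ext; simp
  rw [h1, h.map_eq, Measure.map_apply (by fun_prop) (measurableSet_singleton 0), h2,
    poissonMeasure_singleton]
  simp [ENNReal.coe_toNNReal_eq_toReal]

/-- An empty configuration misses every region, and regions of intensity at least `C` are missed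
with probability at most `exp (-C)`; let `C` tend to infinity. This disposes of the default value of
`Metric.infDist` on the empty set. -/
theorem ae_nonempty (hΦ : IsPoissonPointProcess Φ Λ P)
    (hΛ : ∀ C : ℝ, ∃ B, MeasurableSet B ∧ Λ B ≠ ⊤ ∧ C ≤ (Λ B).toReal) :
    ∀ᵐ ω ∂P, (Φ ω).carrier.Nonempty := by
  have key : ∀ C : ℝ, P {ω | ¬ (Φ ω).carrier.Nonempty} ≤ ENNReal.ofReal (Real.exp (-C)) := by
    intro C
    obtain ⟨B, hB, hfin, hC⟩ := hΛ C
    calc P {ω | ¬ (Φ ω).carrier.Nonempty} ≤ P {ω | (Φ ω).count B = 0} := by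
          refine measure_mono fun ω hω => ?_
          rw [mem_ofPred_eq, not_nonempty_iff_eq_empty] at hω
          simp [Config.count_eq_zero, hω]
      _ = ENNReal.ofReal (Real.exp (-(Λ B).toReal)) := hΦ.measure_count_eq_zero hB hfin
      _ ≤ _ := by gcongr
  have hlim : Filter.Tendsto (fun C : ℝ => ENNReal.ofReal (Real.exp (-C))) Filter.atTop
      (nhds 0) := by
    simpa using ENNReal.tendsto_ofReal Real.tendsto_exp_neg_atTop_nhds_zero
  exact nonpos_iff_eq_zero.1 (ge_of_tendsto' hlim key)

theorem measure_le_infDist (hΦ : IsPoissonPointProcess Φ Λ P)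
    (hne : ∀ᵐ ω ∂P, (Φ ω).carrier.Nonempty) {g : E → F} {p : F} {r : ℝ}
    (hm : MeasurableSet (g ⁻¹' Metric.ball p r)) (hfin : Λ (g ⁻¹' Metric.ball p r) ≠ ⊤) :
    P {ω | r ≤ Metric.infDist p (g '' (Φ ω).carrier)} =
      ENNReal.ofReal (Real.exp (-(Λ (g ⁻¹' Metric.ball p r)).toReal)) := by
  rw [← hΦ.measure_count_eq_zero hm hfin]
  refine measure_congr ?_
  filter_upwards [hne] with ω hω
  exact propext (Config.le_infDist_iff hω)

theorem measure_lt_infDist [OpensMeasurableSpace E] (hΦ : IsPoissonPointProcess Φ Λ P)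
    (hne : ∀ᵐ ω ∂P, (Φ ω).carrier.Nonempty) {p : E} {r : ℝ}
    (hfin : Λ (Metric.closedBall p r) ≠ ⊤) :
    P {ω | r < Metric.infDist p (Φ ω).carrier} =
      ENNReal.ofReal (Real.exp (-(Λ (Metric.closedBall p r)).toReal)) := by
  rw [← hΦ.measure_count_eq_zero Metric.isClosed_closedBall.measurableSet hfin]
  refine measure_congr ?_
  filter_upwards [hne] with ω hω
  exact propext (Config.lt_infDist_iff hω)

end IsPoissonPointProcess

end Poisson

/-! ### Areas and volumes cut out by balls -/

section Volume

theorem measurable_onGround : Measurable onGround := by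
  unfold onGround
  refine (WithLp.measurable_toLp 2 _).comp (measurable_pi_lambda _ fun i => ?_)
  fin_cases i <;> simp <;> fun_prop

/-- Pythagoras. When the ball does not reach the ground, the real square root is `0` and both sides
are empty. -/
theorem preimage_onGround_ball (p : Space) {r : ℝ} (hr : 0 < r) :
    onGround ⁻¹' Metric.ball p r = Metric.ball (!₂[p 0, p 1] : Plane) √(r ^ 2 - p 2 ^ 2) := by
  ext x
  rw [mem_preimage, Metric.mem_ball, Metric.mem_ball, EuclideanSpace.dist_eq,
    EuclideanSpace.dist_eq, Real.sqrt_lt_sqrt_iff (by positivity), Real.sqrt_lt' hr]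
  simp [onGround, Fin.sum_univ_three, Fin.sum_univ_two, Real.dist_eq, sq_abs, lt_sub_iff_add_lt]

theorem volume_preimage_onGround_ball (p : Space) {r : ℝ} (hr : 0 < r) :
    volume (onGround ⁻¹' Metric.ball p r) = ENNReal.ofReal (Real.pi * (r ^ 2 - p 2 ^ 2)) := by
  rw [preimage_onGround_ball p hr, EuclideanSpace.volume_ball_fin_two,
    ← ENNReal.ofReal_pow (Real.sqrt_nonneg _), mul_comm, ENNReal.ofReal_mul Real.pi_pos.le]
  congr 1
  rcases le_total 0 (r ^ 2 - p 2 ^ 2) with h | h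
  · rw [Real.sq_sqrt h]
  · simp [Real.sqrt_eq_zero_of_nonpos h, ENNReal.ofReal_of_nonpos h]

theorem volume_sum_sq_lt (a b s : ℝ) :
    volume {w : Fin 2 → ℝ | (w 0 - a) ^ 2 + (w 1 - b) ^ 2 < s} =
      ENNReal.ofReal (Real.pi * s) := by
  have h := (PiLp.volume_preserving_ofLp (Fin 2)).measure_preimage
    (s := {w : Fin 2 → ℝ | (w 0 - a) ^ 2 + (w 1 - b) ^ 2 < s})
    (measurableSet_lt (by fun_prop) (by fun_prop)).nullMeasurableSet
  have h2 : WithLp.ofLp ⁻¹' {w : Fin 2 → ℝ | (w 0 - a) ^ 2 + (w 1 - b) ^ 2 < s} =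
      Metric.ball (!₂[a, b] : Plane) √s := by
    ext x
    rw [Metric.mem_ball, EuclideanSpace.dist_eq, Real.sqrt_lt_sqrt_iff (by positivity)]
    simp [Fin.sum_univ_two, Real.dist_eq, sq_abs]
  rw [← h, h2, EuclideanSpace.volume_ball_fin_two,
    ← ENNReal.ofReal_pow (Real.sqrt_nonneg _), mul_comm, ENNReal.ofReal_mul Real.pi_pos.le]
  congr 1
  rcases le_total 0 s with h | h
  · rw [Real.sq_sqrt h]
  · simp [Real.sqrt_eq_zero_of_nonpos h, ENNReal.ofReal_of_nonpos h]

/-- Cavalieri: the slice at height `z` is a disc. Heights that the ball does not reach contribute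
nothing because `ENNReal.ofReal` truncates negative areas. -/
theorem volume_ball_inter_upper_eq_lintegral (p : Space) {r : ℝ} (hr : 0 < r) :
    volume (Metric.ball p r ∩ {x : Space | 0 < x 2}) =
      ∫⁻ z in Ioi (0 : ℝ), ENNReal.ofReal (Real.pi * (r ^ 2 - (z - p 2) ^ 2)) := by
  -- Split off the height coordinate, so that the volume becomes a product measure.
  have hmp := (volume_preserving_piFinSuccAbove (fun _ : Fin 3 => ℝ) 2).comp
    (PiLp.volume_preserving_ofLp (Fin 3))
  set T : Set (ℝ × (Fin 2 → ℝ)) :=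
    {q | (q.2 0 - p 0) ^ 2 + (q.2 1 - p 1) ^ 2 < r ^ 2 - (q.1 - p 2) ^ 2} ∩ {q | 0 < q.1} with hT
  have hTm : MeasurableSet T :=
    (measurableSet_lt (by fun_prop) (by fun_prop)).inter
      (measurableSet_lt (by fun_prop) (by fun_prop))
  have hpre : Metric.ball p r ∩ {x : Space | 0 < x 2} =
      (MeasurableEquiv.piFinSuccAbove (fun _ : Fin 3 => ℝ) 2 ∘ WithLp.ofLp) ⁻¹' T := by
    ext x
    have h0 : (2 : Fin 3).succAbove (0 : Fin 2) = 0 := rfl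
    have h1 : (2 : Fin 3).succAbove (1 : Fin 2) = 1 := rfl
    rw [mem_inter_iff, Metric.mem_ball, EuclideanSpace.dist_eq, Real.sqrt_lt' hr]
    simp [hT, Fin.sum_univ_three, Real.dist_eq, sq_abs, lt_sub_iff_add_lt, Fin.removeNth, h0, h1]
  rw [hpre, hmp.measure_preimage hTm.nullMeasurableSet, Measure.volume_eq_prod,
    Measure.prod_apply hTm, ← lintegral_indicator measurableSet_Ioi]
  congr 1
  ext z
  by_cases hz : 0 < z
  · rw [indicator_of_mem (by exact hz), ← volume_sum_sq_lt (p 0) (p 1)]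
    congr 1
    ext w
    simp [hT, hz]
  · rw [indicator_of_notMem (by exact hz)]
    have he : Prod.mk z ⁻¹' T = ∅ := by
      ext w
      simp [hT, hz]
    rw [he, measure_empty]

/-- Since `p 2 < r`, the ball crosses the ground, and the slices have nonnegative area exactly up to
height `p 2 + r`. -/
theorem volume_ball_inter_upper_of_lt (p : Space) {r : ℝ} (hp : 0 ≤ p 2) (hr : p 2 < r) :
    volume (Metric.ball p r ∩ {x : Space | 0 < x 2}) =
      ENNReal.ofReal (Real.pi * (2 / 3 * r ^ 3 + r ^ 2 * p 2 - p 2 ^ 3 / 3)) := by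
  have hr0 : 0 < r := hp.trans_lt hr
  rw [volume_ball_inter_upper_eq_lintegral p hr0]
  set h := p 2
  have hle : (0 : ℝ) ≤ h + r := by linarith
  have h0 : ∫⁻ z in Ioi (h + r), ENNReal.ofReal (Real.pi * (r ^ 2 - (z - h) ^ 2)) = 0 := by
    rw [setLIntegral_congr_fun (g := fun _ => 0) measurableSet_Ioi, lintegral_zero]
    intro z hz
    have hz : h + r < z := hz
    exact ENNReal.ofReal_of_nonpos
      (mul_nonpos_of_nonneg_of_nonpos Real.pi_pos.le (by nlinarith))
  have hcont : Continuous fun z : ℝ => Real.pi * (r ^ 2 - (z - h) ^ 2) := by fun_prop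
  rw [← Ioc_union_Ioi_eq_Ioi hle, lintegral_union measurableSet_Ioi
    (Set.disjoint_left.2 fun x hx hx' => not_lt.2 hx.2 hx'), h0, add_zero,
    ← ofReal_integral_eq_lintegral_ofReal
      (hcont.integrableOn_Ioc)
      ((ae_restrict_iff' measurableSet_Ioc).2 (ae_of_all _ fun z hz =>
        mul_nonneg Real.pi_pos.le (by nlinarith [hz.1, hz.2]))),
    ← intervalIntegral.integral_of_le hle]
  congr 1
  have hd : ∀ z ∈ uIcc 0 (h + r), HasDerivAt
      (fun z => Real.pi * (r ^ 2 * z - (z - h) ^ 3 / 3)) (Real.pi * (r ^ 2 - (z - h) ^ 2)) z := by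
    intro z _
    have := (((hasDerivAt_id z).const_mul (r ^ 2)).sub
      ((((hasDerivAt_id z).sub_const h).pow 3).div_const 3)).const_mul Real.pi
    refine HasDerivAt.congr_deriv this ?_
    simp
  rw [intervalIntegral.integral_eq_sub_of_hasDerivAt hd (hcont.intervalIntegrable _ _)]
  ring

theorem ball_inter_upper_of_le (p : Space) {r : ℝ} (hr : r ≤ p 2) :
    Metric.ball p r ∩ {x : Space | 0 < x 2} = Metric.ball p r := by
  refine inter_eq_left.2 fun x hx => ?_
  have h1 : |p 2 - x 2| ≤ dist x p := by
    rw [EuclideanSpace.dist_eq, ← Real.sqrt_sq_eq_abs]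
    refine Real.sqrt_le_sqrt ?_
    simp only [Fin.sum_univ_three, Real.dist_eq, sq_abs]
    nlinarith [sq_nonneg (x 0 - p 0), sq_nonneg (x 1 - p 1)]
  have h2 := (le_abs_self _).trans_lt (h1.trans_lt hx)
  change 0 < x 2
  linarith

end Volume

/-! ### Intensities of balls -/

section Intensity

/-- The void exponent of a ball of radius `r` around a point of height `h` for a homogeneous
Poisson process of unit intensity in the upper half space. -/
noncomputable def voidExponent (h r : ℝ) : ℝ :=
  if r ≤ h then 4 / 3 * Real.pi * r ^ 3
  else 4 / 3 * Real.pi * r ^ 3 - 1 / 3 * Real.pi * (2 * r ^ 3 - 3 * r ^ 2 * h + h ^ 3)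

theorem voidExponent_of_lt {h r : ℝ} (hr : h < r) :
    voidExponent h r =
      4 / 3 * Real.pi * r ^ 3 - 1 / 3 * Real.pi * (2 * r ^ 3 - 3 * r ^ 2 * h + h ^ 3) :=
  if_neg (not_le.2 hr)

theorem voidExponent_nonneg {h r : ℝ} (hh : 0 ≤ h) (hr : 0 ≤ r) : 0 ≤ voidExponent h r := by
  unfold voidExponent
  split_ifs with hrh
  · positivity
  · push Not at hrh
    have : 0 ≤ Real.pi * (2 / 3 * r ^ 3 + r ^ 2 * h - h ^ 3 / 3) := by
      refine mul_nonneg Real.pi_pos.le ?_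
      have := pow_le_pow_left₀ hh hrh.le 3
      have : 0 ≤ r ^ 2 * h := by positivity
      have : 0 ≤ h ^ 3 := by positivity
      linarith
    linarith

theorem intensityUAVBS_ball {lam : ℝ} (hlam : 0 < lam) (p : Space) {r : ℝ} (hp : 0 ≤ p 2)
    (hr : 0 ≤ r) :
    intensityUAVBS lam (Metric.ball p r) = ENNReal.ofReal (lam * voidExponent (p 2) r) := by
  rw [intensityUAVBS, Measure.smul_apply, Measure.restrict_apply Metric.isOpen_ball.measurableSet,
    smul_eq_mul, ENNReal.ofReal_mul hlam.le, voidExponent]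
  congr 1
  split_ifs with h
  · rw [ball_inter_upper_of_le p h, EuclideanSpace.volume_ball_fin_three,
      ← ENNReal.ofReal_pow hr, ← ENNReal.ofReal_mul (by positivity)]
    congr 1
    ring
  · rw [volume_ball_inter_upper_of_lt p hp (not_le.1 h)]
    congr 1
    ring

/-- Spheres are Lebesgue null. This is what rules out ties between the two tiers. -/
theorem intensityUAVBS_closedBall {lam : ℝ} (p : Space) {r : ℝ}  :
    intensityUAVBS lam (Metric.closedBall p r) = intensityUAVBS lam (Metric.ball p r) := by
  refine measure_congr ?_
  rw [← Metric.ball_union_sphere]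
  refine union_ae_eq_left_of_ae_eq_empty (ae_eq_empty.2 ?_)
  have h : volume.restrict {x : Space | 0 < x 2} (Metric.sphere p r) = 0 :=
    nonpos_iff_eq_zero.1 ((Measure.restrict_apply_le _ _).trans_eq (Measure.addHaar_sphere _ _ _))
  rw [intensityUAVBS, Measure.smul_apply, h, smul_zero]

theorem intensityTBS_preimage_ball {lam : ℝ} (hlam : 0 < lam) (p : Space) {r : ℝ} (hr : 0 < r) :
    intensityTBS lam (onGround ⁻¹' Metric.ball p r) =
      ENNReal.ofReal (lam * (Real.pi * (r ^ 2 - p 2 ^ 2))) := by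
  rw [intensityTBS, Measure.smul_apply, volume_preimage_onGround_ball p hr, smul_eq_mul,
    ENNReal.ofReal_mul hlam.le]

end Intensity

/-! ### Tail probabilities of the two distances -/

section Laws

variable {Ω : Type*} [MeasurableSpace Ω] {P : Measure Ω} {ΦM : Ω → Config Plane}
  {ΦB : Ω → Config Space} {lam : ℝ}

theorem ae_nonempty_TBS (hlam : 0 < lam) (hΦ : IsPoissonPointProcess ΦM (intensityTBS lam) P) :
    ∀ᵐ ω ∂P, (ΦM ω).carrier.Nonempty := by
  refine hΦ.ae_nonempty fun C => ?_
  -- With `t = |C| / (lam * π)` the disc of radius `t + 1` suffices: `(t + 1) ^ 2 ≥ t`, so its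
  -- intensity is at least `|C|`.
  have hr : 0 < |C| / (lam * Real.pi) + 1 := by positivity
  refine ⟨onGround ⁻¹' Metric.ball 0 (|C| / (lam * Real.pi) + 1),
    measurable_onGround Metric.isOpen_ball.measurableSet, ?_, ?_⟩
  · rw [intensityTBS_preimage_ball hlam 0 hr]
    exact ENNReal.ofReal_ne_top
  · rw [intensityTBS_preimage_ball hlam 0 hr, ENNReal.toReal_ofReal']
    refine le_max_of_le_left ?_
    have h2 : C ≤ lam * Real.pi * (|C| / (lam * Real.pi)) := by
      rw [mul_div_cancel₀ _ (by positivity)]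
      exact le_abs_self C
    have h3 : 0 ≤ |C| / (lam * Real.pi) := by positivity
    refine h2.trans ?_
    rw [mul_assoc]
    simp only [PiLp.zero_apply]
    gcongr
    nlinarith

theorem ae_nonempty_UAVBS (hlam : 0 < lam)
    (hΦ : IsPoissonPointProcess ΦB (intensityUAVBS lam) P) :
    ∀ᵐ ω ∂P, (ΦB ω).carrier.Nonempty := by
  refine hΦ.ae_nonempty fun C => ?_
  set s := |C| / (lam * Real.pi) with hs
  have hs0 : 0 ≤ s := by positivity
  -- The half ball of radius `3 * s + 1` at the origin has volume `2 / 3 * π * (3 * s + 1) ^ 3 ≥ π *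
  -- s`.
  have hr : 0 < 3 * s + 1 := by positivity
  have hB := intensityUAVBS_ball hlam 0 (r := 3 * s + 1) (by simp) hr.le
  refine ⟨Metric.ball 0 (3 * s + 1), Metric.isOpen_ball.measurableSet, ?_, ?_⟩
  · rw [hB]
    exact ENNReal.ofReal_ne_top
  · rw [hB, ENNReal.toReal_ofReal']
    refine le_max_of_le_left ?_
    have h2 : C ≤ lam * Real.pi * s := by
      rw [hs, mul_div_cancel₀ _ (by positivity)]
      exact le_abs_self C
    refine h2.trans ?_
    rw [mul_assoc]
    rw [PiLp.zero_apply, voidExponent_of_lt hr]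
    gcongr
    have h3 : s ≤ 2 / 3 * (3 * s + 1) ^ 3 := by nlinarith [mul_nonneg hs0 hs0, pow_nonneg hs0 3]
    nlinarith [Real.pi_pos, mul_le_mul_of_nonneg_left h3 Real.pi_pos.le]

theorem measure_le_dUB (hlam : 0 < lam) (hΦ : IsPoissonPointProcess ΦB (intensityUAVBS lam) P)
    {p : Space} {r : ℝ} (hp : 0 ≤ p 2) (hr : 0 ≤ r) :
    P {ω | r ≤ dUB (ΦB ω) p} = ENNReal.ofReal (Real.exp (-(lam * voidExponent (p 2) r))) := by
  have hB := intensityUAVBS_ball hlam p hp hr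
  have h := hΦ.measure_le_infDist (ae_nonempty_UAVBS hlam hΦ) (g := id) (p := p) (r := r)
    Metric.isOpen_ball.measurableSet (by rw [preimage_id, hB]; exact ENNReal.ofReal_ne_top)
  rw [preimage_id, hB, ENNReal.toReal_ofReal
    (mul_nonneg hlam.le (voidExponent_nonneg hp hr))] at h
  simpa [dUB] using h

theorem measure_lt_dUB (hlam : 0 < lam) (hΦ : IsPoissonPointProcess ΦB (intensityUAVBS lam) P)
    {p : Space} {r : ℝ} (hp : 0 ≤ p 2) (hr : 0 ≤ r) :
    P {ω | r < dUB (ΦB ω) p} = ENNReal.ofReal (Real.exp (-(lam * voidExponent (p 2) r))) := by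
  have hB := intensityUAVBS_ball hlam p hp hr
  have h := hΦ.measure_lt_infDist (ae_nonempty_UAVBS hlam hΦ) (p := p) (r := r)
    (by rw [intensityUAVBS_closedBall, hB]; exact ENNReal.ofReal_ne_top)
  rwa [intensityUAVBS_closedBall, hB, ENNReal.toReal_ofReal
    (mul_nonneg hlam.le (voidExponent_nonneg hp hr))] at h

theorem measure_le_dMB (hlam : 0 < lam) (hΦ : IsPoissonPointProcess ΦM (intensityTBS lam) P)
    {p : Space} {r : ℝ} (hr : 0 < r) :
    P {ω | r ≤ dMB (ΦM ω) p} =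
      ENNReal.ofReal (Real.exp (-max (lam * (Real.pi * (r ^ 2 - p 2 ^ 2))) 0)) := by
  have hB := intensityTBS_preimage_ball hlam p hr
  have h := hΦ.measure_le_infDist (ae_nonempty_TBS hlam hΦ) (p := p) (r := r)
    (measurable_onGround Metric.isOpen_ball.measurableSet)
    (by rw [hB]; exact ENNReal.ofReal_ne_top)
  rwa [hB, ENNReal.toReal_ofReal'] at h

theorem measurable_dMB (p : Space) : Measurable fun φ => dMB φ p :=
  Config.measurable_infDist measurable_onGround p

theorem measurable_dUB (p : Space) : Measurable fun φ => dUB φ p := by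
  simpa [dUB] using Config.measurable_infDist measurable_id p

end Laws

/-! ### From received powers to distances -/

section Scaling

variable {α PM PUB : ℝ}

/-- The ratio of distances to the two tiers at which the received powers agree. -/
noncomputable def distRatio (α PM PUB : ℝ) : ℝ := (PUB / PM) ^ (1 / α)

theorem distRatio_pos (hPM : 0 < PM) (hPUB : 0 < PUB) : 0 < distRatio α PM PUB := by
  unfold distRatio; positivity

/-- The case `s = 1` simplifies the argument of `FUBcap` in the upper integrand, the case `s = 3`
the power in the lower one. -/
theorem rpow_neg_div_eq (hα : 0 < α) (hPM : 0 < PM) (hPUB : 0 < PUB) {x : ℝ} (hx : 0 ≤ x)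
    (s : ℝ) :
    (PM / PUB * x ^ (-α)) ^ (-(s / α)) = (distRatio α PM PUB * x) ^ s := by
  have h1 : PM / PUB = (PUB / PM)⁻¹ := (inv_div _ _).symm
  rw [Real.mul_rpow (by positivity) (by positivity), ← Real.rpow_mul hx,
    Real.mul_rpow (distRatio_pos hPM hPUB).le hx, distRatio, ← Real.rpow_mul (by positivity), h1,
    Real.inv_rpow (by positivity), Real.rpow_neg (by positivity), inv_inv]
  congr 2
  · ring
  · field_simp

/-- This also covers `cos θ = 0`: a real power of `0` with nonzero exponent is `0`, so both sides
vanish. -/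
theorem ell_eq (hα : 0 < α) (hPM : 0 < PM) (hPUB : 0 < PUB) {d θ : ℝ}
    (h : 0 ≤ d * Real.cos θ) :
    ell α PM PUB d θ = d * Real.cos θ / distRatio α PM PUB := by
  rw [ell, Real.mul_rpow (by positivity) (by positivity), ← Real.rpow_mul h, distRatio,
    Real.rpow_neg (by positivity) (1 / α), div_eq_mul_inv _ (_ ^ _)]
  congr 1
  rw [show -α * -(1 / α) = 1 by field_simp, Real.rpow_one]

/-- The wavelength factor cancels and `t ↦ t ^ (-α)` is strictly decreasing on positive reals. Zero
distances are excluded because `0 ^ (-α)` evaluates to `0`. -/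
theorem rxPower_lt_rxPower_iff {lamc P₁ P₂ x y : ℝ} (hlamc : 0 < lamc) (hα : 0 < α) (h₁ : 0 < P₁)
    (h₂ : 0 < P₂) (hx : 0 < x) (hy : 0 < y) :
    rxPower lamc α P₁ x < rxPower lamc α P₂ y ↔ y < distRatio α P₁ P₂ * x := by
  have hc : 0 < (lamc / (4 * Real.pi)) ^ 2 := by positivity
  have hr := rpow_neg_div_eq hα h₁ h₂ hx.le 1
  rw [Real.rpow_one] at hr
  rw [rxPower, rxPower, mul_assoc, mul_assoc, mul_lt_mul_iff_right₀ hc, ← hr,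
    ← Real.rpow_lt_rpow_iff_of_neg (z := -α) (by positivity) hy (neg_lt_zero.2 hα),
    ← Real.rpow_mul (by positivity), show -(1 / α) * -α = 1 by field_simp, Real.rpow_one,
    div_mul_eq_mul_div, div_lt_iff₀ h₂, mul_comm P₂]

theorem distRatio_mul_distRatio (hPM : 0 < PM) (hPUB : 0 < PUB) :
    distRatio α PUB PM * distRatio α PM PUB = 1 := by
  rw [distRatio, distRatio, ← Real.mul_rpow (by positivity) (by positivity),
    div_mul_div_cancel₀ hPUB.ne', div_self hPM.ne', Real.one_rpow]

end Scaling

/-! ### The densities and their antiderivatives -/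

section Density

variable {lam d θ : ℝ}

theorem hasDerivAt_neg_exp_sq (lam h x : ℝ) :
    HasDerivAt (fun x => -Real.exp (-Real.pi * lam * (x ^ 2 - h ^ 2)))
      (2 * x * Real.pi * lam * Real.exp (-Real.pi * lam * (x ^ 2 - h ^ 2))) x := by
  have := ((((hasDerivAt_id x).pow 2).sub_const (h ^ 2)).const_mul (-Real.pi * lam)).exp.neg
  refine HasDerivAt.congr_deriv this ?_
  simp
  ring

theorem tendsto_neg_exp_sq (hlam : 0 < lam) (h : ℝ) :
    Filter.Tendsto (fun x : ℝ => -Real.exp (-Real.pi * lam * (x ^ 2 - h ^ 2))) Filter.atTop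
      (nhds 0) := by
  rw [← neg_zero]
  refine (Real.tendsto_exp_atBot.comp ?_).neg
  refine Filter.Tendsto.const_mul_atTop_of_neg (by nlinarith [Real.pi_pos]) ?_
  exact Filter.tendsto_atTop_add_const_right _ _ (Filter.tendsto_pow_atTop two_ne_zero)

theorem fMB_nonneg (hlam : 0 < lam) (h : 0 ≤ d * Real.cos θ) (x : ℝ) : 0 ≤ fMB lam d θ x := by
  unfold fMB
  split_ifs with hx
  · have := h.trans hx
    positivity
  · rfl

theorem fMB_eq_indicator : fMB lam d θ = indicator (Ici (d * Real.cos θ)) fun x =>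
    2 * x * Real.pi * lam * Real.exp (-Real.pi * lam * (x ^ 2 - (d * Real.cos θ) ^ 2)) := by
  ext x
  simp [fMB, indicator]

theorem measurable_fMB : Measurable (fMB lam d θ) := by
  rw [fMB_eq_indicator]
  exact Measurable.indicator (by fun_prop) measurableSet_Ici

theorem integrable_fMB (hlam : 0 < lam) (h : 0 ≤ d * Real.cos θ) :
    Integrable (fMB lam d θ) := by
  rw [fMB_eq_indicator, integrable_indicator_iff measurableSet_Ici,
    integrableOn_Ici_iff_integrableOn_Ioi]
  refine integrableOn_Ioi_deriv_of_nonneg' (fun x _ => hasDerivAt_neg_exp_sq lam _ x)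
    (fun x hx => ?_) (tendsto_neg_exp_sq hlam _)
  have := h.trans (le_of_lt hx)
  positivity

/-- The maximum appears because the density vanishes below the height; the tail is then read off
from the explicit antiderivative. -/
theorem lintegral_Ici_fMB (hlam : 0 < lam) (h : 0 ≤ d * Real.cos θ) (a : ℝ) :
    ∫⁻ x in Ici a, ENNReal.ofReal (fMB lam d θ x) =
      ENNReal.ofReal (Real.exp
        (-Real.pi * lam * (max a (d * Real.cos θ) ^ 2 - (d * Real.cos θ) ^ 2))) := by
  set c := max a (d * Real.cos θ)
  have hc : 0 ≤ c := h.trans (le_max_right _ _)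
  rw [← ofReal_integral_eq_lintegral_ofReal (integrable_fMB hlam h).integrableOn
    (ae_of_all _ (fMB_nonneg hlam h)), fMB_eq_indicator, setIntegral_indicator measurableSet_Ici,
    Ici_inter_Ici, integral_Ici_eq_integral_Ioi,
    integral_Ioi_of_hasDerivAt_of_nonneg' (fun x _ => hasDerivAt_neg_exp_sq lam _ x)
      (fun x hx => ?_) (tendsto_neg_exp_sq hlam _)]
  · simp [c]
  · have : 0 ≤ x := hc.trans (le_of_lt hx)
    positivity

theorem hasDerivAt_FUBcap (x : ℝ) : HasDerivAt (FUBcap lam d θ) (fUBcap lam d θ x) x := by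
  set h := d * Real.cos θ with hh
  have h2 := (hasDerivAt_id x).pow 2
  have h3 := (hasDerivAt_id x).pow 3
  have := ((((h3.const_mul (4 / 3 * Real.pi)).sub
    ((((h3.const_mul 2).sub ((h2.const_mul 3).mul_const h)).add_const (h ^ 3)).const_mul
      (1 / 3 * Real.pi))).const_mul (-lam)).exp).const_sub 1
  refine HasDerivAt.congr_deriv this ?_
  simp only [fUBcap, ← hh, Pi.pow_apply, id]
  rw [mul_comm (Real.exp _), ← neg_mul]
  congr 1
  · simp
    ring
  · congr 1
    simp only [Pi.sub_apply]
    ring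

theorem FUBcap_eq {x : ℝ} (hx : d * Real.cos θ < x) :
    FUBcap lam d θ x = 1 - Real.exp (-(lam * voidExponent (d * Real.cos θ) x)) := by
  rw [voidExponent_of_lt hx, FUBcap, neg_mul]

theorem measurable_voidExponent (h : ℝ) : Measurable (voidExponent h) :=
  Measurable.ite measurableSet_Iic (by fun_prop) (by fun_prop)

end Density

/-! ### Laws of the distances and the comparison probability -/

section DistanceLaws

variable {Ω : Type*} [MeasurableSpace Ω] {P : Measure Ω} [IsProbabilityMeasure P]
  {ΦM : Ω → Config Plane} {ΦB : Ω → Config Space} {lam lamM lamUB α PM PUB d θ : ℝ} {p : Space}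

/-- Finite measures on the line are determined by the half-lines `Ici a`; there the void probability
meets the tail of `fMB`. The case `a ≤ 0` is separate because the void formula needs a positive
radius. -/
theorem map_dMB (hlam : 0 < lam) (hΦ : IsPoissonPointProcess ΦM (intensityTBS lam) P)
    (hp : p 2 = d * Real.cos θ) (h : 0 ≤ d * Real.cos θ) :
    P.map (fun ω => dMB (ΦM ω) p) =
      volume.withDensity fun x => ENNReal.ofReal (fMB lam d θ x) := by
  have hm : Measurable fun ω => dMB (ΦM ω) p := (measurable_dMB p).comp hΦ.measurable
  have : IsProbabilityMeasure (P.map fun ω => dMB (ΦM ω) p) :=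
    Measure.isProbabilityMeasure_map hm.aemeasurable
  refine Measure.ext_of_Ici _ _ fun a => ?_
  rw [withDensity_apply _ measurableSet_Ici, lintegral_Ici_fMB hlam h,
    Measure.map_apply hm measurableSet_Ici]
  change P {ω | a ≤ dMB (ΦM ω) p} = _
  rcases le_or_gt a 0 with ha | ha
  · have : {ω | a ≤ dMB (ΦM ω) p} = univ :=
      eq_univ_of_forall fun ω => ha.trans Metric.infDist_nonneg
    rw [this, measure_univ, max_eq_right (ha.trans h)]
    simp
  · rw [measure_le_dMB hlam hΦ ha, hp]
    congr 2
    rcases le_total a (d * Real.cos θ) with hle | hle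
    · rw [max_eq_right hle, max_eq_right]
      · simp
      · have : a ^ 2 ≤ (d * Real.cos θ) ^ 2 := pow_le_pow_left₀ ha.le hle 2
        exact mul_nonpos_of_nonneg_of_nonpos hlam.le
          (mul_nonpos_of_nonneg_of_nonpos Real.pi_pos.le (by linarith))
    · rw [max_eq_left hle, max_eq_left]
      · ring
      · have : (d * Real.cos θ) ^ 2 ≤ a ^ 2 := pow_le_pow_left₀ h hle 2
        exact mul_nonneg hlam.le (mul_nonneg Real.pi_pos.le (by linarith))

theorem ae_dMB_pos (hlam : 0 < lam) (hΦ : IsPoissonPointProcess ΦM (intensityTBS lam) P)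
    (hp : p 2 = d * Real.cos θ) (h : 0 ≤ d * Real.cos θ) : ∀ᵐ ω ∂P, 0 < dMB (ΦM ω) p := by
  have hm : Measurable fun ω => dMB (ΦM ω) p := (measurable_dMB p).comp hΦ.measurable
  have h0 : P.map (fun ω => dMB (ΦM ω) p) {0} = 0 := by
    rw [map_dMB hlam hΦ hp h]
    exact withDensity_absolutelyContinuous _ _ (measure_singleton 0)
  rw [Measure.map_apply hm (measurableSet_singleton 0)] at h0
  have h1 : ∀ᵐ ω ∂P, ω ∉ (fun ω => dMB (ΦM ω) p) ⁻¹' {0} := measure_eq_zero_iff_ae_notMem.1 h0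
  filter_upwards [h1] with ω hω
  exact lt_of_le_of_ne Metric.infDist_nonneg (Ne.symm hω)

theorem ae_dUB_pos (hlam : 0 < lam) (hΦ : IsPoissonPointProcess ΦB (intensityUAVBS lam) P)
    (hp : 0 ≤ p 2) : ∀ᵐ ω ∂P, 0 < dUB (ΦB ω) p := by
  have hm : Measurable fun ω => dUB (ΦB ω) p := (measurable_dUB p).comp hΦ.measurable
  have h := measure_lt_dUB hlam hΦ hp le_rfl
  rw [voidExponent, if_pos hp] at h
  exact (prob_compl_eq_zero_iff (measurableSet_lt measurable_const hm)).2 (by simpa using h)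

theorem measureReal_dUB_le (hlam : 0 < lam)
    (hΦ : IsPoissonPointProcess ΦB (intensityUAVBS lam) P) (hp : 0 ≤ p 2) {r : ℝ} (hr : 0 ≤ r) :
    P.real {ω | dUB (ΦB ω) p ≤ r} = 1 - Real.exp (-(lam * voidExponent (p 2) r)) := by
  have hm : Measurable fun ω => dUB (ΦB ω) p := (measurable_dUB p).comp hΦ.measurable
  have h := probReal_compl_eq_one_sub (μ := P)
    (measurableSet_lt (measurable_const (a := r)) hm)
  rw [measureReal_def P {ω | r < dUB (ΦB ω) p}, measure_lt_dUB hlam hΦ hp hr,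
    ENNReal.toReal_ofReal (Real.exp_pos _).le] at h
  rw [← h]
  congr 1
  ext ω
  simp

/-- The integrand of the association probability with the UAV-BS tier: the distribution function
of the distance to the closest UAV-BS at `k x` times the density of the distance to the closest
TBS at `x`. -/
noncomputable def assocIntegrand (lamM lamUB k d θ x : ℝ) : ℝ :=
  (1 - Real.exp (-(lamUB * voidExponent (d * Real.cos θ) (k * x)))) * fMB lamM d θ x

theorem measurable_assocIntegrand (lamM lamUB k d θ : ℝ) :
    Measurable (assocIntegrand lamM lamUB k d θ) := by
  have := measurable_voidExponent (d * Real.cos θ)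
  have := measurable_fMB (lam := lamM) (d := d) (θ := θ)
  unfold assocIntegrand
  fun_prop

theorem assocIntegrand_mem_Icc (hM : 0 < lamM) (hUB : 0 < lamUB) {k : ℝ} (hk : 0 < k)
    (h : 0 ≤ d * Real.cos θ) (x : ℝ) :
    assocIntegrand lamM lamUB k d θ x ∈ Icc 0 (fMB lamM d θ x) := by
  rcases lt_or_ge x (d * Real.cos θ) with hx | hx
  · simp [assocIntegrand, fMB, not_le.2 hx]
  · have h1 := voidExponent_nonneg h (mul_nonneg hk.le (h.trans hx))
    have h2 : Real.exp (-(lamUB * voidExponent (d * Real.cos θ) (k * x))) ≤ 1 :=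
      Real.exp_le_one_iff.2 (neg_nonpos.2 (mul_nonneg hUB.le h1))
    have h3 := fMB_nonneg hM h x
    exact ⟨mul_nonneg (sub_nonneg.2 h2) h3,
      mul_le_of_le_one_left h3 (sub_le_self _ (Real.exp_pos _).le)⟩

theorem integrable_assocIntegrand (hM : 0 < lamM) (hUB : 0 < lamUB) {k : ℝ} (hk : 0 < k)
    (h : 0 ≤ d * Real.cos θ) : Integrable (assocIntegrand lamM lamUB k d θ) := by
  refine (integrable_fMB hM h).mono' (measurable_assocIntegrand ..).aestronglyMeasurable
    (ae_of_all _ fun x => ?_)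
  have := assocIntegrand_mem_Icc hM hUB hk h x
  rw [Real.norm_of_nonneg this.1]
  exact this.2

/-- Independence makes the joint law of the distances a product; Fubini integrates out `dUB` first.
-/
theorem measure_dUB_dMB_eq_lintegral (hM : 0 < lamM)
    (hΦM : IsPoissonPointProcess ΦM (intensityTBS lamM) P) (hΦB : Measurable ΦB)
    (hindep : IndepFun ΦM ΦB P) (hp : p 2 = d * Real.cos θ) (h : 0 ≤ d * Real.cos θ)
    {T : Set (ℝ × ℝ)} (hT : MeasurableSet T) :
    P {ω | (dMB (ΦM ω) p, dUB (ΦB ω) p) ∈ T} =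
      ∫⁻ x, ENNReal.ofReal (fMB lamM d θ x) * P {ω | (x, dUB (ΦB ω) p) ∈ T} := by
  have hmM : Measurable fun ω => dMB (ΦM ω) p := (measurable_dMB p).comp hΦM.measurable
  have hmB : Measurable fun ω => dUB (ΦB ω) p := (measurable_dUB p).comp hΦB
  have hi : IndepFun (fun ω => dMB (ΦM ω) p) (fun ω => dUB (ΦB ω) p) P :=
    hindep.comp (measurable_dMB p) (measurable_dUB p)
  have hprod := (indepFun_iff_map_prod_eq_prod_map_map hmM.aemeasurable hmB.aemeasurable).1 hi
  have h1 : P {ω | (dMB (ΦM ω) p, dUB (ΦB ω) p) ∈ T} =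
      P.map (fun ω => (dMB (ΦM ω) p, dUB (ΦB ω) p)) T := by
    rw [Measure.map_apply (hmM.prodMk hmB) hT]
    rfl
  have := Measure.isProbabilityMeasure_map (μ := P) hmB.aemeasurable
  rw [h1, hprod, Measure.prod_apply hT, map_dMB hM hΦM hp h,
    lintegral_withDensity_eq_lintegral_mul _ (measurable_fMB.ennreal_ofReal)
      (measurable_measure_prodMk_left hT)]
  refine lintegral_congr fun x => ?_
  rw [Pi.mul_apply, Measure.map_apply hmB (hT.preimage measurable_prodMk_left)]
  rfl

theorem measureReal_dUB_lt_mul_dMB (hM : 0 < lamM) (hUB : 0 < lamUB)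
    (hΦM : IsPoissonPointProcess ΦM (intensityTBS lamM) P)
    (hΦB : IsPoissonPointProcess ΦB (intensityUAVBS lamUB) P)
    (hindep : IndepFun ΦM ΦB P) (hp : p 2 = d * Real.cos θ) (h : 0 ≤ d * Real.cos θ)
    {k : ℝ} (hk : 0 < k) :
    P.real {ω | dUB (ΦB ω) p < k * dMB (ΦM ω) p} = ∫ x, assocIntegrand lamM lamUB k d θ x := by
  have hmB : Measurable fun ω => dUB (ΦB ω) p := (measurable_dUB p).comp hΦB.measurable
  have hT : MeasurableSet {q : ℝ × ℝ | q.2 < k * q.1} :=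
    measurableSet_lt (by fun_prop) (by fun_prop)
  have h1 := measure_dUB_dMB_eq_lintegral hM hΦM hΦB.measurable hindep hp h hT
  rw [integral_eq_lintegral_of_nonneg_ae
    (ae_of_all _ fun x => (assocIntegrand_mem_Icc hM hUB hk h x).1)
    (measurable_assocIntegrand ..).aestronglyMeasurable, measureReal_def]
  congr 1
  refine h1.trans (lintegral_congr fun x => ?_)
  rcases lt_or_ge x (d * Real.cos θ) with hx | hx
  · simp [assocIntegrand, fMB, not_le.2 hx]
  · have hx0 : 0 ≤ k * x := mul_nonneg hk.le (h.trans hx)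
    rw [assocIntegrand, mul_comm (1 - _), ENNReal.ofReal_mul (fMB_nonneg hM h x)]
    congr 1
    have h2 := prob_compl_eq_one_sub (μ := P)
      (measurableSet_le (measurable_const (a := k * x)) hmB)
    rw [measure_le_dUB hUB hΦB (hp ▸ h) hx0, hp, ← ENNReal.ofReal_one,
      ← ENNReal.ofReal_sub _ (Real.exp_pos _).le] at h2
    rw [← h2]
    congr 1
    ext ω
    simp

/-- The complement of `dUB < k * dMB` also contains the ties. For each fixed value of `dMB` in the
support these are null, since open and closed balls have the same void probability. -/
theorem measureReal_mul_dMB_lt_dUB (hM : 0 < lamM) (hUB : 0 < lamUB)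
    (hΦM : IsPoissonPointProcess ΦM (intensityTBS lamM) P)
    (hΦB : IsPoissonPointProcess ΦB (intensityUAVBS lamUB) P)
    (hindep : IndepFun ΦM ΦB P) (hp : p 2 = d * Real.cos θ) (h : 0 ≤ d * Real.cos θ)
    {k : ℝ} (hk : 0 < k) :
    P.real {ω | k * dMB (ΦM ω) p < dUB (ΦB ω) p} =
      1 - ∫ x, assocIntegrand lamM lamUB k d θ x := by
  have hmM : Measurable fun ω => dMB (ΦM ω) p := (measurable_dMB p).comp hΦM.measurable
  have hmB : Measurable fun ω => dUB (ΦB ω) p := (measurable_dUB p).comp hΦB.measurable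
  have hT : MeasurableSet {q : ℝ × ℝ | k * q.1 < q.2} :=
    measurableSet_lt (by fun_prop) (by fun_prop)
  have hT' : MeasurableSet {q : ℝ × ℝ | k * q.1 ≤ q.2} :=
    measurableSet_le (by fun_prop) (by fun_prop)
  rw [← measureReal_dUB_lt_mul_dMB hM hUB hΦM hΦB hindep hp h hk,
    ← probReal_compl_eq_one_sub (measurableSet_lt hmB (hmM.const_mul k)), measureReal_def,
    measureReal_def]
  congr 1
  have h1 := measure_dUB_dMB_eq_lintegral hM hΦM hΦB.measurable hindep hp h hT
  have h2 := measure_dUB_dMB_eq_lintegral hM hΦM hΦB.measurable hindep hp h hT'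
  have hc : {ω | dUB (ΦB ω) p < k * dMB (ΦM ω) p}ᶜ =
      {ω | (dMB (ΦM ω) p, dUB (ΦB ω) p) ∈ {q : ℝ × ℝ | k * q.1 ≤ q.2}} := by
    ext ω
    simp
  rw [hc, h2]
  refine h1.trans (lintegral_congr fun x => ?_)
  rcases lt_or_ge x (d * Real.cos θ) with hx | hx
  · simp [fMB, not_le.2 hx]
  · have hx0 : 0 ≤ k * x := mul_nonneg hk.le (h.trans hx)
    congr 1
    exact (measure_lt_dUB hUB hΦB (hp ▸ h) hx0).trans (measure_le_dUB hUB hΦB (hp ▸ h) hx0).symm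

end DistanceLaws

/-! ### Splitting the integral at `ℓ` -/

section Formula

variable {lamM lamUB α PM PUB d θ : ℝ}

theorem upperIntegrand_eq (hα : 0 < α) (hPM : 0 < PM) (hPUB : 0 < PUB) (h : 0 ≤ d * Real.cos θ)
    {x : ℝ} (hx : ell α PM PUB d θ < x) :
    upperIntegrand lamM lamUB α PM PUB d θ x =
      assocIntegrand lamM lamUB (distRatio α PM PUB) d θ x := by
  have hk : 0 < distRatio α PM PUB := distRatio_pos hPM hPUB
  rw [ell_eq hα hPM hPUB h] at hx
  have hx0 : 0 ≤ x := (div_nonneg h hk.le).trans hx.le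
  rw [upperIntegrand, assocIntegrand, rpow_neg_div_eq hα hPM hPUB hx0, Real.rpow_one,
    FUBcap_eq (by rwa [div_lt_iff₀' hk] at hx)]

/-- If `ℓ < h`, the interval is traversed backwards, but there both sides vanish with `fMB`. The
endpoint `x = h` must be excluded: `fMB` need not vanish there, while `k * h > h` puts the void
exponent in its other branch. -/
theorem lowerIntegrand_eq (hα : 0 < α) (hPM : 0 < PM) (hPUB : 0 < PUB) (h : 0 ≤ d * Real.cos θ)
    {x : ℝ} (hx : x ∈ uIoc (d * Real.cos θ) (ell α PM PUB d θ)) (hne : x ≠ d * Real.cos θ) :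
    lowerIntegrand lamM lamUB α PM PUB d θ x =
      assocIntegrand lamM lamUB (distRatio α PM PUB) d θ x := by
  rcases lt_or_gt_of_ne hne with hlt | hgt
  · simp [lowerIntegrand, assocIntegrand, fMB, not_le.2 hlt]
  · have hk : 0 < distRatio α PM PUB := distRatio_pos hPM hPUB
    have hle : x ≤ ell α PM PUB d θ := by
      rcases mem_uIoc.1 hx with h1 | h1
      · exact h1.2
      · exact absurd h1.2 (not_le.2 hgt)
    rw [ell_eq hα hPM hPUB h, le_div_iff₀' hk] at hle
    rw [lowerIntegrand, assocIntegrand, rpow_neg_div_eq hα hPM hPUB (h.trans hgt.le),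
      voidExponent, if_pos hle]
    norm_cast
    congr 3
    ring

theorem ae_lowerIntegrand_eq (hα : 0 < α) (hPM : 0 < PM) (hPUB : 0 < PUB)
    (h : 0 ≤ d * Real.cos θ) :
    ∀ᵐ x, x ∈ uIoc (d * Real.cos θ) (ell α PM PUB d θ) →
      lowerIntegrand lamM lamUB α PM PUB d θ x =
        assocIntegrand lamM lamUB (distRatio α PM PUB) d θ x := by
  have hne : ∀ᵐ x : ℝ, x ∉ ({d * Real.cos θ} : Set ℝ) :=
    measure_eq_zero_iff_ae_notMem.1 (measure_singleton _)
  filter_upwards [hne] with x hx hx'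
  exact lowerIntegrand_eq hα hPM hPUB h hx' hx

theorem intervalIntegrable_lowerIntegrand (hM : 0 < lamM) (hUB : 0 < lamUB) (hα : 0 < α)
    (hPM : 0 < PM) (hPUB : 0 < PUB) (h : 0 ≤ d * Real.cos θ) :
    IntervalIntegrable (lowerIntegrand lamM lamUB α PM PUB d θ) volume (d * Real.cos θ)
      (ell α PM PUB d θ) := by
  have hI := (integrable_assocIntegrand hM hUB (distRatio_pos (α := α) hPM hPUB) h)
  refine (hI.intervalIntegrable (a := d * Real.cos θ) (b := ell α PM PUB d θ)).congr_ae ?_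
  refine (ae_restrict_iff' measurableSet_uIoc).2 ?_
  filter_upwards [ae_lowerIntegrand_eq hα hPM hPUB h] with x hx hx'
  exact (hx hx').symm

theorem integrableOn_upperIntegrand (hM : 0 < lamM) (hUB : 0 < lamUB) (hα : 0 < α)
    (hPM : 0 < PM) (hPUB : 0 < PUB) (h : 0 ≤ d * Real.cos θ) :
    IntegrableOn (upperIntegrand lamM lamUB α PM PUB d θ) (Ioi (ell α PM PUB d θ)) := by
  have hI := (integrable_assocIntegrand hM hUB (distRatio_pos (α := α) hPM hPUB) h)
  exact hI.integrableOn.congr_fun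
    (fun x hx => (upperIntegrand_eq hα hPM hPUB h hx).symm) measurableSet_Ioi

/-- The oriented integral from `h` to `ℓ` plus the one beyond `ℓ` is the integral beyond `h`,
whichever of `h` and `ℓ` is larger; below `h` the integrand is zero. -/
theorem AUB_eq_integral (hM : 0 < lamM) (hUB : 0 < lamUB) (hα : 0 < α)
    (hPM : 0 < PM) (hPUB : 0 < PUB) (h : 0 ≤ d * Real.cos θ) :
    AUB lamM lamUB α PM PUB d θ =
      ∫ x, assocIntegrand lamM lamUB (distRatio α PM PUB) d θ x := by
  have hI := (integrable_assocIntegrand hM hUB (distRatio_pos (α := α) hPM hPUB) h)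
  rw [AUB, intervalIntegral.integral_congr_ae (ae_lowerIntegrand_eq hα hPM hPUB h),
    setIntegral_congr_fun measurableSet_Ioi (fun x hx => upperIntegrand_eq hα hPM hPUB h hx),
    intervalIntegral.integral_interval_add_Ioi hI.integrableOn hI.integrableOn,
    ← integral_Ici_eq_integral_Ioi, setIntegral_eq_integral_of_forall_compl_eq_zero]
  intro x hx
  simp only [mem_Ici] at hx
  simp [assocIntegrand, fMB, hx]

end Formula

/-! ### Association probabilities at a fixed position -/

section FixedPosition

variable {Ω : Type*} [MeasurableSpace Ω] {P : Measure Ω} [IsProbabilityMeasure P]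
  {ΦM : Ω → Config Plane} {ΦB : Ω → Config Space} {lamc lamM lamUB α PM PUB d θ : ℝ} {p : Space}

theorem HasAccessGeometry.height_nonneg (hg : HasAccessGeometry p d θ) :
    0 ≤ d * Real.cos θ :=
  mul_nonneg hg.1.le (Real.cos_nonneg_of_mem_Icc hg.2.1)

theorem HasAccessGeometry.height_eq (hg : HasAccessGeometry p d θ) : p 2 = d * Real.cos θ :=
  hg.2.2.2

theorem measureReal_associatesUB (hlamc : 0 < lamc) (hM : 0 < lamM) (hUB : 0 < lamUB)
    (hα : 0 < α) (hPM : 0 < PM) (hPUB : 0 < PUB)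
    (hΦM : IsPoissonPointProcess ΦM (intensityTBS lamM) P)
    (hΦB : IsPoissonPointProcess ΦB (intensityUAVBS lamUB) P)
    (hindep : IndepFun ΦM ΦB P) (hg : HasAccessGeometry p d θ) :
    P.real {ω | AssociatesUB lamc α PM PUB (ΦM ω) (ΦB ω) p} = AUB lamM lamUB α PM PUB d θ := by
  have h := hg.height_nonneg
  rw [AUB_eq_integral hM hUB hα hPM hPUB h, ← measureReal_dUB_lt_mul_dMB hM hUB hΦM hΦB hindep
    hg.height_eq h (distRatio_pos hPM hPUB)]
  refine measureReal_congr ?_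
  filter_upwards [ae_dMB_pos hM hΦM hg.height_eq h, ae_dUB_pos hUB hΦB (hg.height_eq ▸ h)]
    with ω h1 h2
  exact propext (rxPower_lt_rxPower_iff hlamc hα hPM hPUB h1 h2)

theorem measureReal_associatesMB (hlamc : 0 < lamc) (hM : 0 < lamM) (hUB : 0 < lamUB)
    (hα : 0 < α) (hPM : 0 < PM) (hPUB : 0 < PUB)
    (hΦM : IsPoissonPointProcess ΦM (intensityTBS lamM) P)
    (hΦB : IsPoissonPointProcess ΦB (intensityUAVBS lamUB) P)
    (hindep : IndepFun ΦM ΦB P) (hg : HasAccessGeometry p d θ) :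
    P.real {ω | AssociatesMB lamc α PM PUB (ΦM ω) (ΦB ω) p} =
      1 - AUB lamM lamUB α PM PUB d θ := by
  have h := hg.height_nonneg
  rw [AUB_eq_integral hM hUB hα hPM hPUB h, ← measureReal_mul_dMB_lt_dUB hM hUB hΦM hΦB hindep
    hg.height_eq h (distRatio_pos hPM hPUB)]
  refine measureReal_congr ?_
  filter_upwards [ae_dMB_pos hM hΦM hg.height_eq h, ae_dUB_pos hUB hΦB (hg.height_eq ▸ h)]
    with ω h1 h2
  refine propext ((rxPower_lt_rxPower_iff hlamc hα hPUB hPM h2 h1).trans ?_)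
  change _ ↔ distRatio α PM PUB * dMB (ΦM ω) p < dUB (ΦB ω) p
  have hk : 0 < distRatio α PM PUB := distRatio_pos hPM hPUB
  rw [← mul_lt_mul_iff_right₀ hk, ← mul_assoc, mul_comm _ (distRatio α PUB PM),
    distRatio_mul_distRatio hPM hPUB, one_mul]

end FixedPosition

/-! ### Conditioning on the access distance and angle -/

section Conditional

/-- Freezing: the joint law of `(X, Z)` and `Φ` is a product, so on any event `Z ⁻¹' t` Fubini
replaces the indicator by the probability of its section at `X`, which is `g (Z ω)`. -/
theorem condExp_indicator_eq_of_indepFun {Ω A B C : Type*} [MeasurableSpace Ω]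
    [MeasurableSpace A] [MeasurableSpace B] [MeasurableSpace C] {P : Measure Ω}
    [IsProbabilityMeasure P] {X : Ω → A} {Z : Ω → B} {Φ : Ω → C} (hX : Measurable X)
    (hZ : Measurable Z) (hΦ : Measurable Φ)
    (hindep : IndepFun (fun ω => (X ω, Z ω)) Φ P) {S : Set (A × C)} (hS : MeasurableSet S)
    {g : B → ℝ} (hg : Measurable g)
    (hgS : ∀ᵐ ω ∂P, P.real {ω' | (X ω, Φ ω') ∈ S} = g (Z ω)) :
    P⟦{ω | (X ω, Φ ω) ∈ S} | MeasurableSpace.comap Z inferInstance⟧ =ᵐ[P] fun ω => g (Z ω) := by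
  have hSm : MeasurableSet {ω | (X ω, Φ ω) ∈ S} := (hX.prodMk hΦ) hS
  have hgZ : Measurable fun ω => g (Z ω) := hg.comp hZ
  have hint : Integrable (fun ω => g (Z ω)) P := by
    refine (integrable_const (1 : ℝ)).mono' hgZ.aestronglyMeasurable ?_
    filter_upwards [hgS] with ω hω
    rw [← hω, Real.norm_of_nonneg measureReal_nonneg]
    exact measureReal_le_one
  symm
  refine ae_eq_condExp_of_forall_setIntegral_eq hZ.comap_le
    ((integrable_const (1 : ℝ)).indicator hSm) (fun s _ _ => hint.integrableOn) ?_
    ((hg.comp (comap_measurable Z)).stronglyMeasurable.aestronglyMeasurable)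
  rintro _ ⟨t, ht, rfl⟩ -
  have hs : MeasurableSet (Z ⁻¹' t) := hZ ht
  rw [setIntegral_indicator hSm, setIntegral_const, smul_eq_mul, mul_one,
    integral_eq_lintegral_of_nonneg_ae _ hgZ.aestronglyMeasurable, measureReal_def]
  swap
  · refine ae_restrict_of_ae ?_
    filter_upwards [hgS] with ω hω
    rw [← hω]
    exact measureReal_nonneg
  congr 1
  set T : Set ((A × B) × C) := {q | (q.1.1, q.2) ∈ S} ∩ {q | q.1.2 ∈ t} with hT
  have hTm : MeasurableSet T :=
    (((measurable_fst.comp measurable_fst).prodMk measurable_snd) hS).inter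
      ((measurable_snd.comp measurable_fst) ht)
  have hXZ : Measurable fun ω => (X ω, Z ω) := hX.prodMk hZ
  have hprod := (indepFun_iff_map_prod_eq_prod_map_map hXZ.aemeasurable hΦ.aemeasurable).1 hindep
  have := Measure.isProbabilityMeasure_map (μ := P) hΦ.aemeasurable
  have h1 : P (Z ⁻¹' t ∩ {ω | (X ω, Φ ω) ∈ S}) =
      P.map (fun ω => ((X ω, Z ω), Φ ω)) T := by
    rw [Measure.map_apply (hXZ.prodMk hΦ) hTm, inter_comm]
    rfl
  rw [h1, hprod, Measure.prod_apply hTm,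
    lintegral_map (measurable_measure_prodMk_left hTm) hXZ, ← lintegral_indicator hs]
  refine lintegral_congr_ae ?_
  filter_upwards [hgS] with ω hω
  rw [Measure.map_apply hΦ (hTm.preimage measurable_prodMk_left)]
  by_cases hz : Z ω ∈ t
  · rw [indicator_of_mem (by exact hz), ← hω, ofReal_measureReal]
    congr 1
    ext ω'
    simp [hT, hz]
  · rw [indicator_of_notMem (by exact hz)]
    have he : Φ ⁻¹' (Prod.mk (X ω, Z ω) ⁻¹' T) = ∅ := by
      ext ω'
      simp [hT, hz]
    rw [he, measure_empty]

/-- A position with access distance `d` and angle `θ`. -/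
noncomputable def accessPoint (d θ : ℝ) : Space := !₂[d * Real.sin θ, 0, d * Real.cos θ]

theorem hasAccessGeometry_accessPoint {p : Space} {d θ : ℝ} (hg : HasAccessGeometry p d θ) :
    HasAccessGeometry (accessPoint d θ) d θ := by
  refine ⟨hg.1, hg.2.1, ?_, by simp [accessPoint]⟩
  rw [EuclideanSpace.dist_eq, Real.sqrt_eq_iff_mul_self_eq (by positivity) hg.1.le]
  simp [accessPoint, Fin.sum_univ_three, sq_abs]
  linear_combination d ^ 2 * Real.sin_sq_add_cos_sq θ

theorem measurable_accessPoint : Measurable fun z : ℝ × ℝ => accessPoint z.1 z.2 := by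
  unfold accessPoint
  refine (WithLp.measurable_toLp 2 _).comp (measurable_pi_lambda _ fun i => ?_)
  fin_cases i <;> simp <;> fun_prop

/-- `A` is not assumed measurable. It is replaced by the section probability at `accessPoint`, which
is measurable by Fubini and equals `A` wherever the geometry is admissible. -/
theorem condExp_eq_of_forall_hasAccessGeometry {Ω C : Type*} [MeasurableSpace Ω]
    [MeasurableSpace C] {P : Measure Ω} [IsProbabilityMeasure P] {X : Ω → Space} {d θ : Ω → ℝ}
    {Φ : Ω → C} (hX : Measurable X) (hd : Measurable d) (hθ : Measurable θ) (hΦ : Measurable Φ)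
    (hgeom : ∀ᵐ ω ∂P, HasAccessGeometry (X ω) (d ω) (θ ω))
    (hindep : IndepFun (fun ω => (X ω, d ω, θ ω)) Φ P) {S : Set (Space × C)}
    (hS : MeasurableSet S) {A : ℝ → ℝ → ℝ}
    (hA : ∀ p d θ, HasAccessGeometry p d θ → P.real {ω | (p, Φ ω) ∈ S} = A d θ) :
    P⟦{ω | (X ω, Φ ω) ∈ S} | MeasurableSpace.comap (fun ω => (d ω, θ ω)) inferInstance⟧
      =ᵐ[P] fun ω => A (d ω) (θ ω) := by
  have := Measure.isProbabilityMeasure_map (μ := P) hΦ.aemeasurable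
  have hg : Measurable fun z : ℝ × ℝ => P.real {ω | (accessPoint z.1 z.2, Φ ω) ∈ S} := by
    have h := ((measurable_measure_prodMk_left (ν := P.map Φ) hS).comp
      measurable_accessPoint).ennreal_toReal
    convert h using 2 with z
    rw [measureReal_def, Function.comp_apply,
      Measure.map_apply hΦ (hS.preimage measurable_prodMk_left)]
    rfl
  have h := condExp_indicator_eq_of_indepFun hX (hd.prodMk hθ) hΦ hindep hS hg (by
    filter_upwards [hgeom] with ω hω
    rw [hA _ _ _ hω, hA _ _ _ (hasAccessGeometry_accessPoint hω)])
  refine h.trans ?_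
  filter_upwards [hgeom] with ω hω
  exact hA _ _ _ (hasAccessGeometry_accessPoint hω)

/-- Joint measurability follows from continuity in the position and measurability in the
configuration. -/
theorem measurable_uncurry_dMB :
    Measurable fun q : Space × Config Plane => dMB q.2 q.1 := by
  have hc : ∀ φ : Config Plane, Continuous fun p : Space => dMB φ p := fun φ => by
    unfold dMB
    exact Metric.continuous_infDist_pt _
  exact measurable_uncurry_of_continuous_of_measurable hc measurable_dMB

theorem measurable_uncurry_dUB :
    Measurable fun q : Space × Config Space => dUB q.2 q.1 := by
  have hc : ∀ φ : Config Space, Continuous fun p : Space => dUB φ p := fun φ => by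
    unfold dUB
    exact Metric.continuous_infDist_pt _
  exact measurable_uncurry_of_continuous_of_measurable hc measurable_dUB

theorem measurable_rxPower (lamc α Ptx : ℝ) : Measurable (rxPower lamc α Ptx) := by
  unfold rxPower; fun_prop

theorem measurable_comp_fst_snd_fst {A B C : Type*} [MeasurableSpace A] [MeasurableSpace B]
    [MeasurableSpace C] {f : A × B → ℝ} (hf : Measurable f) :
    Measurable fun q : A × (B × C) => f (q.1, q.2.1) := by
  fun_prop

theorem measurable_comp_fst_snd_snd {A B C : Type*} [MeasurableSpace A] [MeasurableSpace B]
    [MeasurableSpace C] {f : A × C → ℝ} (hf : Measurable f) :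
    Measurable fun q : A × (B × C) => f (q.1, q.2.2) := by
  fun_prop

theorem measurable_rxPower_dMB (lamc α Ptx : ℝ) :
    Measurable fun q : Space × (Config Plane × Config Space) =>
      rxPower lamc α Ptx (dMB q.2.1 q.1) :=
  measurable_comp_fst_snd_fst ((measurable_rxPower lamc α Ptx).comp measurable_uncurry_dMB)

theorem measurable_rxPower_dUB (lamc α Ptx : ℝ) :
    Measurable fun q : Space × (Config Plane × Config Space) =>
      rxPower lamc α Ptx (dUB q.2.2 q.1) :=
  measurable_comp_fst_snd_snd ((measurable_rxPower lamc α Ptx).comp measurable_uncurry_dUB)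

theorem measurableSet_associatesUB (lamc α PM PUB : ℝ) :
    MeasurableSet {q : Space × (Config Plane × Config Space) |
      AssociatesUB lamc α PM PUB q.2.1 q.2.2 q.1} :=
  measurableSet_lt (measurable_rxPower_dMB ..) (measurable_rxPower_dUB ..)

theorem measurableSet_associatesMB (lamc α PM PUB : ℝ) :
    MeasurableSet {q : Space × (Config Plane × Config Space) |
      AssociatesMB lamc α PM PUB q.2.1 q.2.2 q.1} :=
  measurableSet_lt (measurable_rxPower_dUB ..) (measurable_rxPower_dMB ..)

end Conditional

end XHaul

theorem lemma7 {Ω : Type*} [MeasurableSpace Ω] (P : Measure Ω) [IsProbabilityMeasure P]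
    (lamc lamM lamUB α PM PUB : ℝ) (hlamc : 0 < lamc) (hlamM : 0 < lamM) (hlamUB : 0 < lamUB)
    (hα : 0 < α) (hPM : 0 < PM) (hPUB : 0 < PUB)
    (ΦM : Ω → XHaul.Config XHaul.Plane) (ΦB : Ω → XHaul.Config XHaul.Space)
    (hΦM : XHaul.IsPoissonPointProcess ΦM (XHaul.intensityTBS lamM) P)
    (hΦB : XHaul.IsPoissonPointProcess ΦB (XHaul.intensityUAVBS lamUB) P)
    (hindep : IndepFun ΦM ΦB P) :
    -- association probabilities of a UAV-AP with given access distance and angle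
    (∀ (d θ : ℝ) (p : XHaul.Space), XHaul.HasAccessGeometry p d θ →
      IntervalIntegrable (XHaul.lowerIntegrand lamM lamUB α PM PUB d θ) volume
        (d * Real.cos θ) (XHaul.ell α PM PUB d θ) ∧
      IntegrableOn (XHaul.upperIntegrand lamM lamUB α PM PUB d θ)
        (Ioi (XHaul.ell α PM PUB d θ)) volume ∧
      P.real {ω | XHaul.AssociatesUB lamc α PM PUB (ΦM ω) (ΦB ω) p}
        = XHaul.AUB lamM lamUB α PM PUB d θ ∧
      P.real {ω | XHaul.AssociatesMB lamc α PM PUB (ΦM ω) (ΦB ω) p}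
        = 1 - XHaul.AUB lamM lamUB α PM PUB d θ ∧
      -- `F''` is the distribution function of the distance to the closest UAV-BS above the height,
      -- with density `f''`
      (∀ x : ℝ, d * Real.cos θ < x →
        P.real {ω | XHaul.dUB (ΦB ω) p ≤ x} = XHaul.FUBcap lamUB d θ x ∧
        HasDerivAt (XHaul.FUBcap lamUB d θ) (XHaul.fUBcap lamUB d θ x) x)) ∧
    -- the same as conditional probabilities given the access distance and angle of a random
    -- tagged UAV-AP whose location is independent of the TBSs and the UAV-BSs
    (∀ (X : Ω → XHaul.Space) (d θ : Ω → ℝ), Measurable X → Measurable d → Measurable θ →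
      (∀ᵐ ω ∂P, XHaul.HasAccessGeometry (X ω) (d ω) (θ ω)) →
      IndepFun (fun ω => (X ω, d ω, θ ω)) (fun ω => (ΦM ω, ΦB ω)) P →
      P⟦{ω | XHaul.AssociatesUB lamc α PM PUB (ΦM ω) (ΦB ω) (X ω)} |
          MeasurableSpace.comap (fun ω => (d ω, θ ω)) inferInstance⟧
        =ᵐ[P] (fun ω => XHaul.AUB lamM lamUB α PM PUB (d ω) (θ ω)) ∧
      P⟦{ω | XHaul.AssociatesMB lamc α PM PUB (ΦM ω) (ΦB ω) (X ω)} |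
          MeasurableSpace.comap (fun ω => (d ω, θ ω)) inferInstance⟧
        =ᵐ[P] (fun ω => 1 - XHaul.AUB lamM lamUB α PM PUB (d ω) (θ ω))) := by
  refine ⟨fun d θ p hg => ?_, fun X d θ hX hd hθ hgeom hind => ?_⟩
  · have h := hg.height_nonneg
    refine ⟨XHaul.intervalIntegrable_lowerIntegrand hlamM hlamUB hα hPM hPUB h,
      XHaul.integrableOn_upperIntegrand hlamM hlamUB hα hPM hPUB h,
      XHaul.measureReal_associatesUB hlamc hlamM hlamUB hα hPM hPUB hΦM hΦB hindep hg,
      XHaul.measureReal_associatesMB hlamc hlamM hlamUB hα hPM hPUB hΦM hΦB hindep hg,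
      fun x hx => ⟨?_, XHaul.hasDerivAt_FUBcap x⟩⟩
    rw [XHaul.measureReal_dUB_le hlamUB hΦB (hg.height_eq ▸ h) (h.trans hx.le), hg.height_eq,
      XHaul.FUBcap_eq hx]
  · have hΦ := hΦM.measurable.prodMk hΦB.measurable
    exact ⟨XHaul.condExp_eq_of_forall_hasAccessGeometry hX hd hθ hΦ hgeom hind
        (XHaul.measurableSet_associatesUB lamc α PM PUB) fun p d θ hg =>
          XHaul.measureReal_associatesUB hlamc hlamM hlamUB hα hPM hPUB hΦM hΦB hindep hg,
      XHaul.condExp_eq_of_forall_hasAccessGeometry hX hd hθ hΦ hgeom hind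
        (XHaul.measurableSet_associatesMB lamc α PM PUB)
        (A := fun d θ => 1 - XHaul.AUB lamM lamUB α PM PUB d θ) fun p d θ hg =>
          XHaul.measureReal_associatesMB hlamc hlamM hlamUB hα hPM hPUB hΦM hΦB hindep hg⟩
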